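/- All topological vector spaces are real and Hausdorff. An extension of a topological vector space $Z$ by a topological vector space $Y$ is a short exact sequence $0\to Y\xrightarrow{\imath}X\xrightarrow{\pi}Z\to 0$, where $X$ is a topological vector space and $\imath$, $\pi$ are continuous linear maps which are open onto their images. Two extensions $0\to Y\xrightarrow{\imath}X\xrightarrow{\pi}Z\to 0$ and $0\to Y\xrightarrow{\imath'}X'\xrightarrow{\pi'}Z\to 0$ are equivalent if there is a continuous linear map $T:X\to X'$ with $T\circ\imath=\imath'$ and $\pi'\circ T=\pi$ (such a $T$ is automatically a topological isomorphism). Let $\mathrm{Ext}_{\mathrm{TVS}}(Z,Y)$ be the abelian group of equivalence classes of extensions of $Z$ by $Y$, with the operation induced by the Baer sum $E_1+E_2=\nabla_Y\big((E_1\times E_2)\Delta_Z\big)$, that is, the push-out along $\nabla_Y:Y\times Y\to Y$, $(y,y')\mapsto y+y'$, of the pull-back along $\Delta_Z:Z\to Z\times Z$, $z\mapsto(z,z)$, of the product extension $0\to Y\times Y\to X_1\times X_2\to Z\times Z\to 0$. Theorem. Let $Z$ be a topological vector space, let $Y$ be a complete metrizable topological vector space, and let $D$ be a dense linear subspace of $Z$,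 with the subspace topology. Then the abelian groups $\mathrm{Ext}_{\mathrm{TVS}}(Z,Y)$ and $\mathrm{Ext}_{\mathrm{TVS}}(D,Y)$ are isomorphic. -/

import Mathlib

open Topology

universe u v

/-- An extension `0 → Y → X → Z → 0` of real topological vector spaces: a short exact sequence of
continuous linear maps between Hausdorff topological vector spaces, whose maps are open onto their
images. (So `ι` is a topological embedding and `π` is an open surjection. The space `X` is in
bijection with `Y × Z`, hence the universe `max u v` is large enough.) -/
structure TVSExtension (Z : Type u) (Y : Type v)
    [AddCommGroup Z] [Module ℝ Z] [TopologicalSpace Z]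
    [AddCommGroup Y] [Module ℝ Y] [TopologicalSpace Y] : Type (max u v + 1) where
  /-- the middle space -/
  X : Type (max u v)
  [instAddCommGroup : AddCommGroup X]
  [instModule : Module ℝ X]
  [instTopologicalSpace : TopologicalSpace X]
  [instIsTopologicalAddGroup : IsTopologicalAddGroup X]
  [instContinuousSMul : ContinuousSMul ℝ X]
  [instT2Space : T2Space X]
  /-- the inclusion -/
  ι : Y →L[ℝ] X
  /-- the projection -/
  π : X →L[ℝ] Z
  isEmbedding_ι : IsEmbedding ι
  isOpenMap_π : IsOpenMap π
  surjective_π : Function.Surjective π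
  exact : Function.Exact ι π

namespace TVSExtension

attribute [instance] instAddCommGroup instModule instTopologicalSpace instIsTopologicalAddGroup
  instContinuousSMul instT2Space

/-- A topological group which is an extension of a Hausdorff group by a Hausdorff group is
Hausdorff. -/
theorem t2Space_of_exact {Y X Z : Type*} [AddCommGroup Y] [AddCommGroup X] [AddCommGroup Z]
    [Module ℝ Y] [Module ℝ X] [Module ℝ Z]
    [TopologicalSpace Y] [TopologicalSpace X] [TopologicalSpace Z]
    [IsTopologicalAddGroup X] [T2Space Y] [T2Space Z]
    (i : Y →L[ℝ] X) (p : X →L[ℝ] Z) (hi : IsInducing i) (he : Function.Exact i p) :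
    T2Space X := by
  have : T0Space X := by
    refine ⟨fun a b hab => ?_⟩
    have h1 : p a = p b := (hab.map p.continuous).eq
    have h2 : p (a - b) = 0 := by rw [map_sub, h1, sub_self]
    obtain ⟨y, hy⟩ := (he _).1 h2
    have h3 : Inseparable (i y) (i 0) := by
      have := hab.map (f := fun x => x - b) (by fun_prop)
      rw [hy, map_zero]
      simpa using this
    have h4 : y = 0 := ((hi.inseparable_iff).1 h3).eq
    rw [h4, map_zero] at hy
    exact (sub_eq_zero.1 hy.symm)
  infer_instance

section Basic

variable {Z : Type u} {Y : Type v}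
  [AddCommGroup Z] [Module ℝ Z] [TopologicalSpace Z]
  [AddCommGroup Y] [Module ℝ Y] [TopologicalSpace Y]

@[simp] theorem π_ι (E : TVSExtension Z Y) (y : Y) : E.π (E.ι y) = 0 :=
  (E.exact _).2 ⟨y, rfl⟩

/-- Two extensions of `Z` by `Y` are equivalent if there is a morphism between the middle spaces
which commutes with the inclusions of `Y` and the projections to `Z`. -/
def Equivalent (E E' : TVSExtension Z Y) : Prop :=
  ∃ T : E.X →L[ℝ] E'.X, (∀ y, T (E.ι y) = E'.ι y) ∧ ∀ x, E'.π (T x) = E.π x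

theorem Equivalent.refl (E : TVSExtension Z Y) : E.Equivalent E :=
  ⟨ContinuousLinearMap.id ℝ E.X, fun _ => rfl, fun _ => rfl⟩

theorem Equivalent.trans {E E' E'' : TVSExtension Z Y} (h : E.Equivalent E')
    (h' : E'.Equivalent E'') : E.Equivalent E'' := by
  obtain ⟨T, h1, h2⟩ := h
  obtain ⟨S, h3, h4⟩ := h'
  exact ⟨S.comp T, fun y => by simp [h1, h3], fun x => by simp [h2, h4]⟩

/-- The morphism in the definition of equivalence is a topological isomorphism. -/
theorem Equivalent.symm {E E' : TVSExtension Z Y} (h : E.Equivalent E') : E'.Equivalent E := by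
  obtain ⟨T, h1, h2⟩ := h
  have hinj : Function.Injective T := by
    rw [injective_iff_map_eq_zero]
    intro x hx
    have : E.π x = 0 := by rw [← h2, hx, map_zero]
    obtain ⟨y, rfl⟩ := (E.exact _).1 this
    rw [h1] at hx
    have : y = 0 := E'.isEmbedding_ι.injective (by rw [hx, map_zero])
    rw [this, map_zero]
  have hsurj : Function.Surjective T := by
    intro x'
    obtain ⟨x, hx⟩ := E.surjective_π (E'.π x')
    have : E'.π (x' - T x) = 0 := by rw [map_sub, h2, hx, sub_self]
    obtain ⟨y, hy⟩ := (E'.exact _).1 this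
    exact ⟨x + E.ι y, by rw [map_add, h1, hy]; abel⟩
  have key : ∀ U ∈ 𝓝 (0 : E.X), ∃ V ∈ 𝓝 (0 : E'.X), ∀ x, T x ∈ V → x ∈ U := by
    intro U hU
    obtain ⟨W, hW, hWU⟩ := exists_nhds_zero_half hU
    have hW1 : E.ι ⁻¹' W ∈ 𝓝 (0 : Y) :=
      E.ι.continuous.continuousAt.preimage_mem_nhds (by rwa [map_zero])
    rw [E'.isEmbedding_ι.isInducing.nhds_eq_comap, map_zero] at hW1
    obtain ⟨V1, hV1, hV1W⟩ := hW1
    obtain ⟨V2, hV2, hV2V⟩ : ∃ V ∈ 𝓝 (0 : E'.X), ∀ a ∈ V, ∀ b ∈ V, a - b ∈ V1 := by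
      have h : Filter.Tendsto (fun p : E'.X × E'.X => p.1 - p.2) (𝓝 0 ×ˢ 𝓝 0) (𝓝 0) := by
        rw [← nhds_prod_eq]
        exact Continuous.tendsto' (by fun_prop) _ _ (by simp)
      obtain ⟨V, hV, hVV⟩ := Filter.mem_prod_same_iff.1 (h hV1)
      exact ⟨V, hV, fun a ha b hb => hVV (Set.mk_mem_prod ha hb)⟩
    have hW' : W ∩ T ⁻¹' V2 ∈ 𝓝 (0 : E.X) :=
      Filter.inter_mem hW (T.continuous.continuousAt.preimage_mem_nhds (by rwa [map_zero]))
    have hP : E.π '' (W ∩ T ⁻¹' V2) ∈ 𝓝 (0 : Z) := by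
      have := E.isOpenMap_π.image_mem_nhds hW'
      rwa [map_zero] at this
    refine ⟨V2 ∩ E'.π ⁻¹' (E.π '' (W ∩ T ⁻¹' V2)), Filter.inter_mem hV2
      (E'.π.continuous.continuousAt.preimage_mem_nhds (by rwa [map_zero])), ?_⟩
    rintro x ⟨hx1, w, ⟨hw1, hw2⟩, hw3⟩
    rw [h2] at hw3
    have : E.π (x - w) = 0 := by rw [map_sub, hw3, sub_self]
    obtain ⟨y, hy⟩ := (E.exact _).1 this
    have hy' : E'.ι y = T x - T w := by rw [← h1, hy, map_sub]
    have hyV : y ∈ E'.ι ⁻¹' V1 := by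
      change E'.ι y ∈ V1
      rw [hy']
      exact hV2V _ hx1 _ hw2
    have : x = w + E.ι y := by rw [hy]; abel
    rw [this]
    exact hWU _ hw1 _ (hV1W hyV)
  let e : E.X ≃ₗ[ℝ] E'.X := LinearEquiv.ofBijective T.toLinearMap ⟨hinj, hsurj⟩
  have he : ∀ x, e x = T x := fun _ => rfl
  have hcont : Continuous e.symm := by
    refine continuous_of_continuousAt_zero e.symm.toLinearMap.toAddMonoidHom ?_
    intro U hU
    change U ∈ 𝓝 (e.symm 0) at hU
    rw [map_zero] at hU
    obtain ⟨V, hV, hVU⟩ := key U hU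
    rw [Filter.mem_map]
    refine Filter.mem_of_superset hV fun x' hx' => hVU (e.symm x') ?_
    rwa [← he, e.apply_symm_apply]
  refine ⟨⟨e.symm.toLinearMap, hcont⟩, fun y => ?_, fun x => ?_⟩
  · change e.symm (E'.ι y) = _
    rw [LinearEquiv.symm_apply_eq, he, h1]
  · change E.π (e.symm x) = _
    rw [← h2, ← he, e.apply_symm_apply]

variable (Z Y) in
/-- Equivalence of extensions, as a setoid. -/
instance setoid : Setoid (TVSExtension Z Y) where
  r := Equivalent
  iseqv := ⟨Equivalent.refl, Equivalent.symm, Equivalent.trans⟩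

end Basic

section Constructions

variable {Z Z₁ Z₂ : Type u} {Y Y₁ Y₂ : Type v}
  [AddCommGroup Z] [Module ℝ Z] [TopologicalSpace Z]
  [AddCommGroup Z₁] [Module ℝ Z₁] [TopologicalSpace Z₁]
  [AddCommGroup Z₂] [Module ℝ Z₂] [TopologicalSpace Z₂]
  [AddCommGroup Y] [Module ℝ Y] [TopologicalSpace Y]
  [AddCommGroup Y₁] [Module ℝ Y₁] [TopologicalSpace Y₁]
  [AddCommGroup Y₂] [Module ℝ Y₂] [TopologicalSpace Y₂]

variable (Z Y) in
/-- The trivial extension `0 → Y → Y × Z → Z → 0`. -/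
def trivial [IsTopologicalAddGroup Z] [ContinuousSMul ℝ Z] [T2Space Z]
    [IsTopologicalAddGroup Y] [ContinuousSMul ℝ Y] [T2Space Y] : TVSExtension Z Y where
  X := Y × Z
  ι := ContinuousLinearMap.inl ℝ Y Z
  π := ContinuousLinearMap.snd ℝ Y Z
  isEmbedding_ι := isEmbedding_prodMkLeft (0 : Z)
  isOpenMap_π := isOpenMap_snd
  surjective_π := Prod.snd_surjective
  exact := by
    rintro ⟨y, z⟩
    constructor
    · rintro rfl
      exact ⟨y, rfl⟩
    · rintro ⟨y', hy⟩
      exact (congrArg Prod.snd hy).symm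

/-- The extension with the inclusion replaced by its opposite. -/
def neg (E : TVSExtension Z Y) : TVSExtension Z Y where
  X := E.X
  ι := -E.ι
  π := E.π
  isEmbedding_ι := (Homeomorph.neg E.X).isEmbedding.comp E.isEmbedding_ι
  isOpenMap_π := E.isOpenMap_π
  surjective_π := E.surjective_π
  exact := by
    intro x
    rw [E.exact x]
    constructor
    · rintro ⟨y, rfl⟩
      exact ⟨-y, by simp⟩
    · rintro ⟨y, rfl⟩
      exact ⟨-y, by simp⟩

/-- The product extension `0 → Y₁ × Y₂ → X₁ × X₂ → Z₁ × Z₂ → 0`. -/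
def prod (E₁ : TVSExtension Z₁ Y₁) (E₂ : TVSExtension Z₂ Y₂) :
    TVSExtension (Z₁ × Z₂) (Y₁ × Y₂) where
  X := E₁.X × E₂.X
  ι := E₁.ι.prodMap E₂.ι
  π := E₁.π.prodMap E₂.π
  isEmbedding_ι := E₁.isEmbedding_ι.prodMap E₂.isEmbedding_ι
  isOpenMap_π := E₁.isOpenMap_π.prodMap E₂.isOpenMap_π
  surjective_π := E₁.surjective_π.prodMap E₂.surjective_π
  exact := by
    rintro ⟨x₁, x₂⟩
    constructor
    · intro h
      obtain ⟨y₁, h₁⟩ := (E₁.exact x₁).1 (congrArg Prod.fst h)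
      obtain ⟨y₂, h₂⟩ := (E₂.exact x₂).1 (congrArg Prod.snd h)
      exact ⟨(y₁, y₂), Prod.ext h₁ h₂⟩
    · rintro ⟨⟨y₁, y₂⟩, h⟩
      rw [← h]
      exact Prod.ext (E₁.π_ι y₁) (E₂.π_ι y₂)

/-- The algebraic pull-back `{(x, w) | π x = t w} ⊆ X × Z₁`. -/
def pullbackSubmodule (E : TVSExtension Z Y) (t : Z₁ →L[ℝ] Z) : Submodule ℝ (E.X × Z₁) where
  carrier := {p | E.π p.1 = t p.2}
  add_mem' {p q} hp hq := by
    change E.π (p.1 + q.1) = t (p.2 + q.2)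
    rw [map_add, map_add, show E.π p.1 = t p.2 from hp, show E.π q.1 = t q.2 from hq]
  zero_mem' := by
    change E.π 0 = t 0
    rw [map_zero, map_zero]
  smul_mem' c p hp := by
    change E.π (c • p.1) = t (c • p.2)
    rw [map_smul, map_smul, show E.π p.1 = t p.2 from hp]

/-- The pull-back extension `E t : 0 → Y → {(x, w) | π x = t w} → Z₁ → 0`, where the middle space
carries the topology induced by `X × Z₁`. -/
def pullback (E : TVSExtension Z Y) (t : Z₁ →L[ℝ] Z)
    [IsTopologicalAddGroup Z₁] [ContinuousSMul ℝ Z₁] [T2Space Z₁] : TVSExtension Z₁ Y where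
  X := E.pullbackSubmodule t
  ι := ((ContinuousLinearMap.inl ℝ E.X Z₁).comp E.ι).codRestrict (E.pullbackSubmodule t) (by
    intro y
    change E.π (E.ι y) = t 0
    rw [π_ι, map_zero])
  π := (ContinuousLinearMap.snd ℝ E.X Z₁).comp (Submodule.subtypeL _)
  isEmbedding_ι := by
    refine IsEmbedding.codRestrict (e := fun y => ((E.ι y, 0) : E.X × Z₁)) ?_ _ _
    exact (isEmbedding_prodMkLeft (0 : Z₁)).comp E.isEmbedding_ι
  isOpenMap_π := by
    rw [isOpenMap_iff_nhds_le]
    rintro ⟨⟨x, w⟩, hx⟩ U hU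
    change E.π x = t w at hx
    rw [Filter.mem_map] at hU
    obtain ⟨V, hV, hVU⟩ := mem_nhds_induced _ _ _ |>.1 hU
    rw [nhds_prod_eq] at hV
    obtain ⟨A, hA, B, hB, hAB⟩ := Filter.mem_prod_iff.1 hV
    have hA' : t ⁻¹' (E.π '' A) ∈ 𝓝 w := by
      refine t.continuous.continuousAt.preimage_mem_nhds ?_
      rw [← hx]
      exact E.isOpenMap_π.image_mem_nhds hA
    filter_upwards [hB, hA']
    rintro w' hw' ⟨x', hx', hxw⟩
    exact hVU (a := ⟨(x', w'), hxw⟩) (hAB (Set.mk_mem_prod hx' hw'))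
  surjective_π := by
    intro w
    obtain ⟨x, hx⟩ := E.surjective_π (t w)
    exact ⟨⟨(x, w), hx⟩, rfl⟩
  exact := by
    rintro ⟨⟨x, w⟩, hx⟩
    constructor
    · intro h
      change w = 0 at h
      subst h
      change E.π x = t 0 at hx
      rw [map_zero] at hx
      obtain ⟨y, rfl⟩ := (E.exact x).1 hx
      exact ⟨y, rfl⟩
    · rintro ⟨y, hy⟩
      exact (congrArg (fun a : E.pullbackSubmodule t => a.1.2) hy).symm

/-- The subspace `{(t y, -ι y) | y ∈ Y} ⊆ Y₁ × X`, by which one divides to form the push-out. -/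
def pushoutSubmodule (E : TVSExtension Z Y) (t : Y →L[ℝ] Y₁) : Submodule ℝ (Y₁ × E.X) :=
  LinearMap.range (t.prod (-E.ι)).toLinearMap

theorem mem_pushoutSubmodule (E : TVSExtension Z Y) (t : Y →L[ℝ] Y₁) (p : Y₁ × E.X) :
    p ∈ E.pushoutSubmodule t ↔ ∃ y, t y = p.1 ∧ -E.ι y = p.2 := by
  constructor
  · rintro ⟨y, rfl⟩
    exact ⟨y, rfl, rfl⟩
  · rintro ⟨y, h1, h2⟩
    exact ⟨y, Prod.ext h1 h2⟩

/-- The inclusion `y ↦ [(y, 0)]` into the push-out. -/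
def pushoutι (E : TVSExtension Z Y) (t : Y →L[ℝ] Y₁) :
    Y₁ →L[ℝ] (Y₁ × E.X) ⧸ E.pushoutSubmodule t where
  toLinearMap := (E.pushoutSubmodule t).mkQ.comp (LinearMap.inl ℝ Y₁ E.X)
  cont := (continuous_quotient_mk').comp (Continuous.prodMk continuous_id continuous_const)

/-- The projection `[(y, x)] ↦ π x` from the push-out. -/
def pushoutπ (E : TVSExtension Z Y) (t : Y →L[ℝ] Y₁) :
    ((Y₁ × E.X) ⧸ E.pushoutSubmodule t) →L[ℝ] Z where
  toLinearMap := (E.pushoutSubmodule t).liftQ (E.π.toLinearMap.comp (LinearMap.snd ℝ Y₁ E.X)) (by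
    intro p hp
    obtain ⟨y, -, hy⟩ := (E.mem_pushoutSubmodule t p).1 hp
    change E.π p.2 = 0
    rw [← hy, map_neg, π_ι, neg_zero])
  cont := (E.π.continuous.comp continuous_snd).quotient_lift _

theorem isInducing_pushoutι (E : TVSExtension Z Y) (t : Y →L[ℝ] Y₁) [IsTopologicalAddGroup Y]
    [IsTopologicalAddGroup Y₁] : IsInducing (E.pushoutι t) := by
  have hle : 𝓝 (0 : Y₁) = Filter.comap (E.pushoutι t) (𝓝 0) := by
    apply le_antisymm
    · rw [← Filter.tendsto_iff_comap]
      exact (E.pushoutι t).continuous.tendsto' _ _ (map_zero _)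
    · intro V hV
      obtain ⟨W, hW, hWV⟩ := exists_nhds_zero_half hV
      have h1 : t ⁻¹' W ∈ 𝓝 (0 : Y) :=
        t.continuous.continuousAt.preimage_mem_nhds (by rwa [map_zero])
      rw [E.isEmbedding_ι.isInducing.nhds_eq_comap, map_zero] at h1
      obtain ⟨A, hA, hAW⟩ := h1
      refine ⟨(E.pushoutSubmodule t).mkQ '' (W ×ˢ A), ?_, ?_⟩
      · have := (E.pushoutSubmodule t).isOpenMap_mkQ.image_mem_nhds
          (x := (0 : Y₁ × E.X)) (s := W ×ˢ A) (prod_mem_nhds hW hA)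
        rwa [map_zero] at this
      · rintro y' ⟨⟨a, b⟩, ⟨ha, hb⟩, hab⟩
        have h2 : (y', (0 : E.X)) - (a, b) ∈ E.pushoutSubmodule t :=
          (Submodule.Quotient.eq _).1 hab.symm
        obtain ⟨y, hy1, hy2⟩ := (E.mem_pushoutSubmodule t _).1 h2
        have hb' : E.ι y = b := by simpa using hy2
        have hy' : y' = a + t y := by
          rw [hy1]
          simp
        rw [hy']
        refine hWV _ ha _ (hAW ?_)
        change E.ι y ∈ A
        rwa [hb']
  exact IsTopologicalAddGroup.isInducing_iff_nhds_zero.2 hle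

theorem exact_pushout (E : TVSExtension Z Y) (t : Y →L[ℝ] Y₁) :
    Function.Exact (E.pushoutι t) (E.pushoutπ t) := by
  intro q
  obtain ⟨⟨y', x⟩, rfl⟩ := (E.pushoutSubmodule t).mkQ_surjective q
  constructor
  · intro h
    change E.π x = 0 at h
    obtain ⟨y, rfl⟩ := (E.exact x).1 h
    refine ⟨y' + t y, (Submodule.Quotient.eq _).2 ?_⟩
    exact (E.mem_pushoutSubmodule t _).2 ⟨y, by simp, by simp⟩
  · rintro ⟨y, hy⟩
    rw [← hy]
    change E.π 0 = 0
    rw [map_zero]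

/-- The push-out extension `t E : 0 → Y₁ → (Y₁ × X) / {(t y, -ι y)} → Z → 0`, where the middle space
carries the quotient topology. -/
def pushout (E : TVSExtension Z Y) (t : Y →L[ℝ] Y₁) [IsTopologicalAddGroup Y] [T2Space Z]
    [IsTopologicalAddGroup Y₁] [ContinuousSMul ℝ Y₁] [T2Space Y₁] : TVSExtension Z Y₁ where
  X := (Y₁ × E.X) ⧸ E.pushoutSubmodule t
  instT2Space := t2Space_of_exact (E.pushoutι t) (E.pushoutπ t) (E.isInducing_pushoutι t)
    (E.exact_pushout t)
  ι := E.pushoutι t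
  π := E.pushoutπ t
  isEmbedding_ι := (E.isInducing_pushoutι t).isEmbedding
  isOpenMap_π := by
    intro U hU
    rw [← Set.image_preimage_eq U (E.pushoutSubmodule t).mkQ_surjective, ← Set.image_comp]
    exact (E.isOpenMap_π.comp isOpenMap_snd) _
      (hU.preimage (E.pushoutSubmodule t).continuous_mkQ)
  surjective_π := by
    intro z
    obtain ⟨x, hx⟩ := E.surjective_π z
    exact ⟨(E.pushoutSubmodule t).mkQ (0, x), hx⟩
  exact := E.exact_pushout t

/-- An extension which completes the push-out diagram is equivalent to the push-out extension. -/
theorem pushout_equivalent (E : TVSExtension Z Y) (t : Y →L[ℝ] Y₁) [IsTopologicalAddGroup Y]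
    [T2Space Z] [IsTopologicalAddGroup Y₁] [ContinuousSMul ℝ Y₁] [T2Space Y₁]
    (E' : TVSExtension Z Y₁) (s : E.X →L[ℝ] E'.X) (h₁ : ∀ y, s (E.ι y) = E'.ι (t y))
    (h₂ : ∀ x, E'.π (s x) = E.π x) : (E.pushout t).Equivalent E' := by
  let f : Y₁ × E.X →L[ℝ] E'.X := E'.ι.coprod s
  have hf : ∀ p : Y₁ × E.X, f p = E'.ι p.1 + s p.2 := fun _ => rfl
  have hker : E.pushoutSubmodule t ≤ LinearMap.ker f.toLinearMap := by
    intro p hp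
    obtain ⟨y, hy1, hy2⟩ := (E.mem_pushoutSubmodule t p).1 hp
    change f p = 0
    rw [hf, ← hy1, ← hy2, map_neg, h₁, add_neg_cancel]
  let T : ((Y₁ × E.X) ⧸ E.pushoutSubmodule t) →L[ℝ] E'.X :=
    ⟨(E.pushoutSubmodule t).liftQ f.toLinearMap hker, f.continuous.quotient_lift _⟩
  refine ⟨T, fun y => ?_, fun q => ?_⟩
  · change f (y, 0) = _
    rw [hf, map_zero, add_zero]
  · obtain ⟨p, rfl⟩ := (E.pushoutSubmodule t).mkQ_surjective q
    change E'.π (f p) = E.π p.2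
    rw [hf, map_add, π_ι, zero_add, h₂]

/-- The canonical map `x ↦ [(0, x)]` into the push-out. -/
def toPushout (E : TVSExtension Z Y) (t : Y →L[ℝ] Y₁) [IsTopologicalAddGroup Y] [T2Space Z]
    [IsTopologicalAddGroup Y₁] [ContinuousSMul ℝ Y₁] [T2Space Y₁] :
    E.X →L[ℝ] (E.pushout t).X where
  toLinearMap := (E.pushoutSubmodule t).mkQ.comp (LinearMap.inr ℝ Y₁ E.X)
  cont := (continuous_quotient_mk').comp (Continuous.prodMk continuous_const continuous_id)

theorem toPushout_ι (E : TVSExtension Z Y) (t : Y →L[ℝ] Y₁) [IsTopologicalAddGroup Y] [T2Space Z]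
    [IsTopologicalAddGroup Y₁] [ContinuousSMul ℝ Y₁] [T2Space Y₁] (y : Y) :
    E.toPushout t (E.ι y) = (E.pushout t).ι (t y) := by
  refine (Submodule.Quotient.eq (E.pushoutSubmodule t)).2 ?_
  exact (E.mem_pushoutSubmodule t _).2 ⟨-y, by simp, by simp⟩

theorem π_toPushout (E : TVSExtension Z Y) (t : Y →L[ℝ] Y₁) [IsTopologicalAddGroup Y] [T2Space Z]
    [IsTopologicalAddGroup Y₁] [ContinuousSMul ℝ Y₁] [T2Space Y₁] (x : E.X) :
    (E.pushout t).π (E.toPushout t x) = E.π x := rfl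

end Constructions

section Baer

variable {Z : Type u} {Y Y₁ Y₂ : Type v}
  [AddCommGroup Z] [Module ℝ Z] [TopologicalSpace Z]
  [IsTopologicalAddGroup Z] [ContinuousSMul ℝ Z] [T2Space Z]
  [AddCommGroup Y] [Module ℝ Y] [TopologicalSpace Y]
  [AddCommGroup Y₁] [Module ℝ Y₁] [TopologicalSpace Y₁]
  [AddCommGroup Y₂] [Module ℝ Y₂] [TopologicalSpace Y₂]

/-- The pull-back `(E₁ × E₂) Δ` of the product extension along the diagonal map
`Δ : Z → Z × Z`. -/
def prodDiag (E₁ : TVSExtension Z Y₁) (E₂ : TVSExtension Z Y₂) : TVSExtension Z (Y₁ × Y₂) :=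
  (E₁.prod E₂).pullback ((ContinuousLinearMap.id ℝ Z).prod (ContinuousLinearMap.id ℝ Z))

/-- The first projection of `(E₁ × E₂) Δ`. -/
def fst (E₁ : TVSExtension Z Y₁) (E₂ : TVSExtension Z Y₂) : (E₁.prodDiag E₂).X →L[ℝ] E₁.X :=
  ((ContinuousLinearMap.fst ℝ E₁.X E₂.X).comp
    (ContinuousLinearMap.fst ℝ (E₁.X × E₂.X) Z)).comp (Submodule.subtypeL _)

/-- The second projection of `(E₁ × E₂) Δ`. -/
def snd (E₁ : TVSExtension Z Y₁) (E₂ : TVSExtension Z Y₂) : (E₁.prodDiag E₂).X →L[ℝ] E₂.X :=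
  ((ContinuousLinearMap.snd ℝ E₁.X E₂.X).comp
    (ContinuousLinearMap.fst ℝ (E₁.X × E₂.X) Z)).comp (Submodule.subtypeL _)

theorem fst_ι (E₁ : TVSExtension Z Y₁) (E₂ : TVSExtension Z Y₂) (y : Y₁ × Y₂) :
    fst E₁ E₂ ((E₁.prodDiag E₂).ι y) = E₁.ι y.1 := rfl

theorem snd_ι (E₁ : TVSExtension Z Y₁) (E₂ : TVSExtension Z Y₂) (y : Y₁ × Y₂) :
    snd E₁ E₂ ((E₁.prodDiag E₂).ι y) = E₂.ι y.2 := rfl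

theorem π_fst (E₁ : TVSExtension Z Y₁) (E₂ : TVSExtension Z Y₂) (p : (E₁.prodDiag E₂).X) :
    E₁.π (fst E₁ E₂ p) = (E₁.prodDiag E₂).π p :=
  congrArg Prod.fst p.2

theorem π_snd (E₁ : TVSExtension Z Y₁) (E₂ : TVSExtension Z Y₂) (p : (E₁.prodDiag E₂).X) :
    E₂.π (snd E₁ E₂ p) = (E₁.prodDiag E₂).π p :=
  congrArg Prod.snd p.2

/-- The universal property of `(E₁ × E₂) Δ`. -/
def lift (E₁ : TVSExtension Z Y₁) (E₂ : TVSExtension Z Y₂) (F : TVSExtension Z Y)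
    (f₁ : F.X →L[ℝ] E₁.X) (f₂ : F.X →L[ℝ] E₂.X) (h₁ : ∀ x, E₁.π (f₁ x) = F.π x)
    (h₂ : ∀ x, E₂.π (f₂ x) = F.π x) : F.X →L[ℝ] (E₁.prodDiag E₂).X :=
  ((f₁.prod f₂).prod F.π).codRestrict ((E₁.prod E₂).pullbackSubmodule
    ((ContinuousLinearMap.id ℝ Z).prod (ContinuousLinearMap.id ℝ Z)))
    (fun x => Prod.ext (h₁ x) (h₂ x))

theorem lift_eq_ι (E₁ : TVSExtension Z Y₁) (E₂ : TVSExtension Z Y₂) (F : TVSExtension Z Y)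
    (f₁ : F.X →L[ℝ] E₁.X) (f₂ : F.X →L[ℝ] E₂.X) (h₁ : ∀ x, E₁.π (f₁ x) = F.π x)
    (h₂ : ∀ x, E₂.π (f₂ x) = F.π x) (y : Y) (y₁ : Y₁) (y₂ : Y₂) (h₃ : f₁ (F.ι y) = E₁.ι y₁)
    (h₄ : f₂ (F.ι y) = E₂.ι y₂) :
    lift E₁ E₂ F f₁ f₂ h₁ h₂ (F.ι y) = (E₁.prodDiag E₂).ι (y₁, y₂) :=
  Subtype.ext (Prod.ext (Prod.ext h₃ h₄) (F.π_ι y))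

variable [IsTopologicalAddGroup Y] [ContinuousSMul ℝ Y] [T2Space Y]

variable (Y) in
/-- The addition map `∇ : Y × Y → Y`. -/
def addMap : Y × Y →L[ℝ] Y :=
  (ContinuousLinearMap.id ℝ Y).coprod (ContinuousLinearMap.id ℝ Y)

/-- The Baer sum `E₁ + E₂ = ∇ ((E₁ × E₂) Δ)`. -/
def baerSum (E₁ E₂ : TVSExtension Z Y) : TVSExtension Z Y :=
  (E₁.prodDiag E₂).pushout (addMap Y)

/-- The canonical map from `(E₁ × E₂) Δ` to the Baer sum. -/
def toBaerSum (E₁ E₂ : TVSExtension Z Y) : (E₁.prodDiag E₂).X →L[ℝ] (E₁.baerSum E₂).X :=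
  (E₁.prodDiag E₂).toPushout (addMap Y)

theorem toBaerSum_ι (E₁ E₂ : TVSExtension Z Y) (y : Y × Y) :
    toBaerSum E₁ E₂ ((E₁.prodDiag E₂).ι y) = (E₁.baerSum E₂).ι (y.1 + y.2) :=
  (E₁.prodDiag E₂).toPushout_ι (addMap Y) y

theorem π_toBaerSum (E₁ E₂ : TVSExtension Z Y) (p : (E₁.prodDiag E₂).X) :
    (E₁.baerSum E₂).π (toBaerSum E₁ E₂ p) = (E₁.prodDiag E₂).π p := rfl

theorem baerSum_equivalent (E₁ E₂ E' : TVSExtension Z Y) (s : (E₁.prodDiag E₂).X →L[ℝ] E'.X)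
    (h₁ : ∀ y, s ((E₁.prodDiag E₂).ι y) = E'.ι (y.1 + y.2))
    (h₂ : ∀ p, E'.π (s p) = (E₁.prodDiag E₂).π p) : (E₁.baerSum E₂).Equivalent E' :=
  (E₁.prodDiag E₂).pushout_equivalent (addMap Y) E' s h₁ h₂

/-- The Baer sum is compatible with equivalence. -/
theorem baerSum_congr {E₁ E₁' E₂ E₂' : TVSExtension Z Y} (h₁ : E₁.Equivalent E₁')
    (h₂ : E₂.Equivalent E₂') : (E₁.baerSum E₂).Equivalent (E₁'.baerSum E₂') := by
  obtain ⟨T₁, h1, h2⟩ := h₁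
  obtain ⟨T₂, h3, h4⟩ := h₂
  refine baerSum_equivalent _ _ _ ((toBaerSum E₁' E₂').comp
    (lift E₁' E₂' (E₁.prodDiag E₂) (T₁.comp (fst E₁ E₂)) (T₂.comp (snd E₁ E₂))
    (fun x => (h2 _).trans (π_fst _ _ _)) (fun x => (h4 _).trans (π_snd _ _ _))))
    (fun y => ?_) (fun p => rfl)
  refine (congrArg (toBaerSum E₁' E₂') ?_).trans (toBaerSum_ι E₁' E₂' y)
  exact lift_eq_ι _ _ _ _ _ _ _ _ _ _ (h1 _) (h3 _)

theorem baerSum_comm (E₁ E₂ : TVSExtension Z Y) :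
    (E₁.baerSum E₂).Equivalent (E₂.baerSum E₁) := by
  refine baerSum_equivalent _ _ _ ((toBaerSum E₂ E₁).comp
    (lift E₂ E₁ (E₁.prodDiag E₂) (snd E₁ E₂) (fst E₁ E₂) (π_snd _ _) (π_fst _ _)))
    (fun y => ?_) (fun p => rfl)
  rw [add_comm]
  refine (congrArg (toBaerSum E₂ E₁) ?_).trans (toBaerSum_ι E₂ E₁ (y.2, y.1))
  exact lift_eq_ι _ _ _ _ _ _ _ _ _ _ rfl rfl

theorem baerSum_assoc (E₁ E₂ E₃ : TVSExtension Z Y) :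
    ((E₁.baerSum E₂).baerSum E₃).Equivalent (E₁.baerSum (E₂.baerSum E₃)) := by
  let F := (E₁.prodDiag E₂).prodDiag E₃
  let p₁₂ : F.X →L[ℝ] (E₁.prodDiag E₂).X := fst (E₁.prodDiag E₂) E₃
  let p₁ : F.X →L[ℝ] E₁.X := (fst E₁ E₂).comp p₁₂
  let p₂ : F.X →L[ℝ] E₂.X := (snd E₁ E₂).comp p₁₂
  let p₃ : F.X →L[ℝ] E₃.X := snd (E₁.prodDiag E₂) E₃
  have h₁₂ : ∀ x, (E₁.prodDiag E₂).π (p₁₂ x) = F.π x := π_fst _ _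
  have h₁ : ∀ x, E₁.π (p₁ x) = F.π x := fun x => (π_fst _ _ _).trans (h₁₂ x)
  have h₂ : ∀ x, E₂.π (p₂ x) = F.π x := fun x => (π_snd _ _ _).trans (h₁₂ x)
  have h₃ : ∀ x, E₃.π (p₃ x) = F.π x := π_snd _ _
  let t : (Y × Y) × Y →L[ℝ] Y := (addMap Y).coprod (ContinuousLinearMap.id ℝ Y)
  have ht : ∀ y, t y = y.1.1 + y.1.2 + y.2 := fun _ => rfl
  let p₂₃ : F.X →L[ℝ] (E₂.prodDiag E₃).X := lift E₂ E₃ F p₂ p₃ h₂ h₃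
  have hA : (F.pushout t).Equivalent ((E₁.baerSum E₂).baerSum E₃) := by
    refine F.pushout_equivalent t _ ((toBaerSum (E₁.baerSum E₂) E₃).comp
      (lift (E₁.baerSum E₂) E₃ F ((toBaerSum E₁ E₂).comp p₁₂) p₃ h₁₂ h₃))
      (fun y => ?_) (fun p => rfl)
    rw [ht]
    refine (congrArg (toBaerSum (E₁.baerSum E₂) E₃) ?_).trans
      (toBaerSum_ι (E₁.baerSum E₂) E₃ (y.1.1 + y.1.2, y.2))
    exact lift_eq_ι _ _ _ _ _ _ _ _ _ _ (toBaerSum_ι E₁ E₂ y.1) rfl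
  have hB : (F.pushout t).Equivalent (E₁.baerSum (E₂.baerSum E₃)) := by
    refine F.pushout_equivalent t _ ((toBaerSum E₁ (E₂.baerSum E₃)).comp
      (lift E₁ (E₂.baerSum E₃) F p₁ ((toBaerSum E₂ E₃).comp p₂₃) h₁ (fun _ => rfl)))
      (fun y => ?_) (fun p => rfl)
    rw [ht, add_assoc]
    refine (congrArg (toBaerSum E₁ (E₂.baerSum E₃)) ?_).trans
      (toBaerSum_ι E₁ (E₂.baerSum E₃) (y.1.1, y.1.2 + y.2))
    refine lift_eq_ι _ _ _ _ _ _ _ _ _ _ rfl ?_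
    refine (congrArg (toBaerSum E₂ E₃) ?_).trans (toBaerSum_ι E₂ E₃ (y.1.2, y.2))
    exact lift_eq_ι _ _ _ _ _ _ _ _ _ _ rfl rfl
  exact hA.symm.trans hB

theorem baerSum_trivial (E : TVSExtension Z Y) : (E.baerSum (trivial Z Y)).Equivalent E := by
  let s₂ : (E.prodDiag (trivial Z Y)).X →L[ℝ] Y :=
    (ContinuousLinearMap.fst ℝ Y Z).comp (snd E (trivial Z Y))
  refine baerSum_equivalent _ _ _ (fst E (trivial Z Y) + E.ι.comp s₂) (fun y => ?_) (fun p => ?_)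
  · rw [map_add]
    rfl
  · change E.π (fst E (trivial Z Y) p + E.ι (s₂ p)) = _
    rw [map_add, π_ι, add_zero, π_fst]

theorem neg_baerSum (E : TVSExtension Z Y) : (E.neg.baerSum E).Equivalent (trivial Z Y) := by
  let f₁ : (E.neg.prodDiag E).X →L[ℝ] E.X := fst E.neg E
  let d : (E.neg.prodDiag E).X →L[ℝ] E.X := snd E.neg E - f₁
  have hdef : ∀ p, d p = snd E.neg E p - f₁ p := fun _ => rfl
  have hf₁ : ∀ p, E.π (f₁ p) = (E.neg.prodDiag E).π p := π_fst E.neg E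
  have hd : ∀ p, ∃ y, E.ι y = d p := fun p => by
    refine (E.exact _).1 ?_
    rw [hdef, map_sub, π_snd, hf₁, sub_self]
  choose g hg using hd
  have hgι : ∀ y, g ((E.neg.prodDiag E).ι y) = y.1 + y.2 := fun y => by
    refine E.isEmbedding_ι.injective ?_
    rw [hg, hdef, snd_ι, map_add, show f₁ ((E.neg.prodDiag E).ι y) = -E.ι y.1 from rfl]
    abel
  let G : (E.neg.prodDiag E).X →L[ℝ] Y :=
    { toFun := g
      map_add' := fun p q => E.isEmbedding_ι.injective (by simp only [hg, map_add])
      map_smul' := fun c p => E.isEmbedding_ι.injective (by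
        simp only [hg, map_smul, RingHom.id_apply])
      cont := E.isEmbedding_ι.isInducing.continuous_iff.2 (by
        convert d.continuous using 1
        exact funext hg) }
  refine baerSum_equivalent _ _ _ (G.prod (E.neg.prodDiag E).π) (fun y => ?_) (fun p => rfl)
  exact Prod.ext (hgι y) (π_ι _ y)

end Baer

end TVSExtension

/-- The set `Ext_TVS(Z, Y)` of equivalence classes of extensions `0 → Y → X → Z → 0` of real
topological vector spaces. -/
def ExtTVS (Z : Type u) (Y : Type v)
    [AddCommGroup Z] [Module ℝ Z] [TopologicalSpace Z]
    [AddCommGroup Y] [Module ℝ Y] [TopologicalSpace Y] : Type (max u v + 1) :=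
  Quotient (TVSExtension.setoid Z Y)

namespace ExtTVS

variable {Z : Type u} {Y : Type v}
  [AddCommGroup Z] [Module ℝ Z] [TopologicalSpace Z]
  [IsTopologicalAddGroup Z] [ContinuousSMul ℝ Z] [T2Space Z]
  [AddCommGroup Y] [Module ℝ Y] [TopologicalSpace Y]
  [IsTopologicalAddGroup Y] [ContinuousSMul ℝ Y] [T2Space Y]

/-- Addition in `Ext_TVS(Z, Y)` is induced by the Baer sum of extensions. -/
instance instAdd : Add (ExtTVS Z Y) where
  add := Quotient.map₂ TVSExtension.baerSum
    (fun _ _ h₁ _ _ h₂ => TVSExtension.baerSum_congr h₁ h₂)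

/-- The zero of `Ext_TVS(Z, Y)` is the class of the trivial extension. -/
instance instZero : Zero (ExtTVS Z Y) where
  zero := Quotient.mk _ (TVSExtension.trivial Z Y)

/-- The opposite of a class is obtained by changing the sign of the inclusion. -/
instance instNeg : Neg (ExtTVS Z Y) where
  neg := Quotient.map TVSExtension.neg (by
    rintro E E' ⟨T, h1, h2⟩
    refine ⟨T, fun y => ?_, h2⟩
    exact (map_neg T (E.ι y)).trans (congrArg Neg.neg (h1 y)))

/-- `Ext_TVS(Z, Y)` is an abelian group with the Baer sum. -/
instance instAddCommGroup : AddCommGroup (ExtTVS Z Y) where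
  add_assoc := by
    rintro ⟨a⟩ ⟨b⟩ ⟨c⟩
    exact Quotient.sound (TVSExtension.baerSum_assoc a b c)
  add_comm := by
    rintro ⟨a⟩ ⟨b⟩
    exact Quotient.sound (TVSExtension.baerSum_comm a b)
  zero_add := by
    rintro ⟨a⟩
    exact Quotient.sound ((TVSExtension.baerSum_comm _ _).trans (TVSExtension.baerSum_trivial a))
  add_zero := by
    rintro ⟨a⟩
    exact Quotient.sound (TVSExtension.baerSum_trivial a)
  neg_add_cancel := by
    rintro ⟨a⟩
    exact Quotient.sound (TVSExtension.neg_baerSum a)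
  nsmul := nsmulRec
  zsmul := zsmulRec

end ExtTVS

/-! The isomorphism is restriction, that is, pull-back along the inclusion of `D` in `Z`; universal
properties show that pull-back respects Baer sums (`baerSum_pullback`).

Injectivity: let π : X → Z be the projection of an extension. A splitting of its restriction to `D`
is a continuous linear retraction onto `Y`, defined on the preimage of `D` in X. As π is open this
preimage is dense, and as `Y` is complete the retraction extends to X. Metrizability of `Y` plays no
role here (`equivalent_trivial_of_pullback`).

Surjectivity: given 0 → Y → X → D → 0, let H be the completion of X and let the new middle space be
the closure in H × Z of the graph of the projection. It is the part of H lying over `Z`, described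
without completing `Z`. Its kernel over `Z` is the closure of `Y` in H, which is `Y` itself by
completeness. What needs proof is that every z in `Z` is reached: the trace on `D` of the
neighbourhoods of z is a Cauchy filter, and it must be lifted to a Cauchy filter on X
(`Cauchy.exists_lift_of_exact`). Metrizability of `Y` enters there: countably many neighbourhoods in
X control the `Y`-direction, so a lift can be built by a recursive choice of points, even though X
need not be first countable. -/

/-! ### Scalar multiplication on the completion. -/

/-- Each single scalar already acts continuously, so joint continuity at (0, 0) passes from the
dense image of `X` to the completion through closed neighbourhoods. Continuity of c ↦ c • x at 0
then follows by approximating x by a point of `X`. -/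
theorem UniformSpace.Completion.continuousSMul_real (X : Type*) [AddCommGroup X] [Module ℝ X]
    [UniformSpace X] [IsUniformAddGroup X] [ContinuousSMul ℝ X]
    [UniformContinuousConstSMul ℝ X] : ContinuousSMul ℝ (UniformSpace.Completion X) := by
  have key : ∀ W ∈ 𝓝 (0 : UniformSpace.Completion X), ∃ S ∈ 𝓝 (0 : ℝ),
      ∃ V ∈ 𝓝 (0 : UniformSpace.Completion X), ∀ c ∈ S, ∀ x ∈ V, c • x ∈ W := by
    intro W hW
    obtain ⟨W', hW', hcl, hWW⟩ := exists_mem_nhds_isClosed_subset hW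
    have h : Filter.Tendsto (fun p : ℝ × X => ((p.1 • p.2 : X) : UniformSpace.Completion X))
        (𝓝 0 ×ˢ 𝓝 0) (𝓝 0) := by
      rw [← nhds_prod_eq]
      exact ((UniformSpace.Completion.continuous_coe X).comp continuous_smul).tendsto' _ _
        (by simp [UniformSpace.Completion.coe_zero])
    obtain ⟨S, hS, A, hA, hSA⟩ := Filter.mem_prod_iff.1 (h hW')
    rw [(UniformSpace.Completion.isDenseInducing_coe (α := X)).isInducing.nhds_eq_comap] at hA
    obtain ⟨V, hV, hVA⟩ := hA
    obtain ⟨O, hOV, hO, h0⟩ := _root_.mem_nhds_iff.1 hV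
    -- `O` is open so that each of its points is a limit of points of `X` lying in `O`; closedness
    -- of `W'` keeps the limit of their multiples inside.
    refine ⟨S, hS, O, hO.mem_nhds h0, fun c hc x hx => hWW ?_⟩
    have h1 : x ∈ closure (O ∩ Set.range ((↑) : X → UniformSpace.Completion X)) :=
      UniformSpace.Completion.denseRange_coe.open_subset_closure_inter hO hx
    have h2 := map_mem_closure (continuous_const_smul c) h1 (t := W') (by
      rintro _ ⟨hy, y, rfl⟩
      change c • (y : UniformSpace.Completion X) ∈ W'
      rw [← UniformSpace.Completion.coe_smul]
      exact hSA (Set.mk_mem_prod hc (hVA (hOV hy))))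
    rwa [hcl.closure_eq] at h2
  refine ContinuousSMul.of_nhds_zero (R := ℝ) (M := UniformSpace.Completion X) ?_ ?_ ?_
  · intro W hW
    obtain ⟨S, hS, V, hV, h⟩ := key W hW
    rw [Filter.mem_map]
    filter_upwards [Filter.prod_mem_prod hS hV] with p hp using h _ hp.1 _ hp.2
  · intro x W hW
    obtain ⟨W', hW', hWW⟩ := exists_nhds_zero_half hW
    obtain ⟨S, hS, V, hV, h⟩ := key W' hW'
    have hx : {y | x - y ∈ V} ∈ 𝓝 x :=
      (Continuous.tendsto' (f := fun y => x - y) (by fun_prop) x 0 (sub_self x)) hV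
    obtain ⟨_, hy, ⟨y, rfl⟩⟩ := mem_closure_iff_nhds.1
      (UniformSpace.Completion.denseRange_coe x) _ hx
    have hc : Filter.Tendsto (fun c : ℝ => ((c • y : X) : UniformSpace.Completion X))
        (𝓝 0) (𝓝 0) :=
      ((UniformSpace.Completion.continuous_coe X).comp (by fun_prop)).tendsto' _ _
        (by simp [UniformSpace.Completion.coe_zero])
    have hcW : ∀ᶠ c : ℝ in 𝓝 0, ((c • y : X) : UniformSpace.Completion X) ∈ W' := hc hW'
    rw [Filter.mem_map]
    filter_upwards [hS, hcW] with c hcS hcy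
    change c • x ∈ W
    have : c • x = c • (x - y) + ((c • y : X) : UniformSpace.Completion X) := by
      rw [UniformSpace.Completion.coe_smul, ← smul_add, sub_add_cancel]
    rw [this]
    exact hWW _ (h _ hcS _ hy) _ hcy
  · intro c
    exact (continuous_const_smul c).tendsto' _ _ (smul_zero c)

/-! ### Lifting Cauchy filters along a quotient map. -/

/-- If a topological group has a first countable subgroup `Y`, there is a sequence of
neighbourhoods of zero, each containing the sums and differences of the elements of the next one,
whose traces on `Y` are arbitrarily small. -/
theorem exists_seq_nhds_zero_of_isInducing {Y X : Type*} [AddCommGroup Y] [AddCommGroup X]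
    [TopologicalSpace Y] [TopologicalSpace X] [IsTopologicalAddGroup X]
    [FirstCountableTopology Y] (i : Y →+ X) (hi : IsInducing i) :
    ∃ U : ℕ → Set X, (∀ n, U n ∈ 𝓝 0) ∧
      (∀ n, ∀ a ∈ U (n + 1), ∀ b ∈ U (n + 1), a + b ∈ U n ∧ a - b ∈ U n) ∧
      ∀ V ∈ 𝓝 (0 : Y), ∃ n, ∀ y, i y ∈ U n → y ∈ V := by
  obtain ⟨B, hB⟩ := (𝓝 (0 : Y)).exists_antitone_basis
  have hA : ∀ n, ∃ A ∈ 𝓝 (0 : X), i ⁻¹' A ⊆ B n := fun n => by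
    have := hB.1.mem_of_mem (i := n) _root_.trivial
    rwa [hi.nhds_eq_comap, map_zero] at this
  choose A hA hAB using hA
  have hhalf : ∀ (U : {U : Set X // U ∈ 𝓝 0}) (n : ℕ), ∃ V : {U : Set X // U ∈ 𝓝 0},
      V.1 ⊆ A n ∧ ∀ a ∈ V.1, ∀ b ∈ V.1, a + b ∈ U.1 ∧ a - b ∈ U.1 := by
    rintro ⟨U, hU⟩ n
    have h : Filter.Tendsto (fun p : X × X => (p.1 + p.2, p.1 - p.2)) (𝓝 0 ×ˢ 𝓝 0) (𝓝 (0, 0)) := by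
      rw [← nhds_prod_eq]
      exact Continuous.tendsto' (by fun_prop) _ _ (by simp)
    obtain ⟨V, hV, hVV⟩ := Filter.mem_prod_same_iff.1 (h (prod_mem_nhds hU hU))
    exact ⟨⟨V ∩ A n, Filter.inter_mem hV (hA n)⟩, Set.inter_subset_right,
      fun a ha b hb => hVV (Set.mk_mem_prod ha.1 hb.1)⟩
  choose next hnext hnext' using hhalf
  let U : ℕ → {U : Set X // U ∈ 𝓝 0} :=
    fun n => Nat.rec ⟨Set.univ, Filter.univ_mem⟩ (fun k V => next V k) n
  refine ⟨fun n => (U n).1, fun n => (U n).2, fun n => hnext' (U n) n, fun V hV => ?_⟩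
  obtain ⟨n, -, hn⟩ := hB.1.mem_iff.1 hV
  -- The recursion starts at the whole space, and only term n + 1 is cut down to `A n`; hence the
  -- shift.
  exact ⟨n + 1, fun y hy => hn (hAB n (hnext (U n) n hy))⟩

/-- Cauchy filters lift along the quotient map of a topological group by a first countable
subgroup. -/
theorem Cauchy.exists_lift_of_exact {Y X D : Type*} [AddCommGroup Y] [AddCommGroup X]
    [AddCommGroup D] [TopologicalSpace Y] [FirstCountableTopology Y]
    [UniformSpace X] [IsUniformAddGroup X] [UniformSpace D] [IsUniformAddGroup D]
    (i : Y →+ X) (p : X →+ D) (hi : IsInducing i) (hp : IsOpenMap p)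
    (hs : Function.Surjective p) (he : Function.Exact i p) {F : Filter D} (hF : Cauchy F) :
    ∃ G : Filter X, Cauchy G ∧ Filter.Tendsto p G F := by
  obtain ⟨U, hU, hUU, hUY⟩ := exists_seq_nhds_zero_of_isInducing i hi
  have := hF.1
  have hsmall : ∀ W ∈ 𝓝 (0 : X), ∃ S ∈ F, ∀ a ∈ S, ∀ b ∈ S, ∃ w ∈ W, p w = b - a := by
    intro W hW
    have h : p '' W ∈ 𝓝 (0 : D) := by simpa using hp.image_mem_nhds hW
    have h' : (fun q : D × D => q.2 - q.1) ⁻¹' (p '' W) ∈ uniformity D := by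
      rw [uniformity_eq_comap_nhds_zero]
      exact Filter.preimage_mem_comap h
    obtain ⟨S, hS, hSS⟩ := (cauchy_iff.1 hF).2 _ h'
    exact ⟨S, hS, fun a ha b hb => hSS (Set.mk_mem_prod ha hb)⟩
  -- The image of `U n` is a neighbourhood of 0, so differences within a small enough member of `F`
  -- lift into `U n`.
  choose S hS hSU using fun n => hsmall (U n) (hU n)
  let T : ℕ → Set D := fun n => ⋂ k ∈ Set.Iic n, S k
  have hT : ∀ n, T n ∈ F := fun n => (Filter.biInter_mem (Set.finite_Iic n)).2 fun k _ => hS k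
  have hTS : ∀ n, T n ⊆ S n := fun n => Set.biInter_subset_of_mem (Set.mem_Iic.2 le_rfl)
  have hTT : ∀ n, T (n + 1) ⊆ T n := fun n =>
    Set.biInter_subset_biInter_left (Set.Iic_subset_Iic.2 n.le_succ)
  have hstep : ∀ (n : ℕ) (x : X), p x ∈ T n → ∃ x', p x' ∈ T (n + 1) ∧ x' - x ∈ U n := by
    intro n x hx
    obtain ⟨d, hd⟩ := hF.1.nonempty_of_mem (hT (n + 1))
    obtain ⟨w, hw, hwd⟩ := hSU n _ (hTS n hx) _ (hTS n (hTT n hd))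
    refine ⟨x + w, ?_, by simpa using hw⟩
    rwa [map_add, hwd, add_sub_cancel]
  obtain ⟨d₀, hd₀⟩ := hF.1.nonempty_of_mem (hT 0)
  obtain ⟨x₀, rfl⟩ := hs d₀
  choose! next hnext hnext' using hstep
  let x : ℕ → X := fun n => Nat.rec x₀ (fun k a => next k a) n
  have hx : ∀ n, p (x n) ∈ T n := fun n => by
    induction n with
    | zero => exact hd₀
    | succ n ih => exact hnext n _ ih
  have hxx : ∀ n, x (n + 1) - x n ∈ U n := fun n => hnext' n _ (hx n)
  -- The sequence `x` need not be Cauchy, since the `U n` need not form a basis at 0. The sets `x n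
  -- + U n + U n` only pin down the `Y`-direction; intersecting with preimages of members of `F`
  -- controls the rest. Two summands from `U n` make `B` decreasing.
  let B : ℕ → Set X := fun n => {a | ∃ u ∈ U n, ∃ v ∈ U n, a = x n + u + v}
  have hB : Antitone B := by
    refine antitone_nat_of_succ_le fun n => ?_
    rintro a ⟨u, hu, v, hv, rfl⟩
    exact ⟨x (n + 1) - x n, hxx n, u + v, (hUU n _ hu _ hv).1, by abel⟩
  have hbasis := (Filter.hasBasis_iInf_principal hB.directed_ge).inf
    (F.basis_sets.comap p)
  refine ⟨(⨅ n, Filter.principal (B n)) ⊓ F.comap p, cauchy_iff.2 ⟨hbasis.neBot_iff.2 ?_, ?_⟩,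
    Filter.tendsto_comap.mono_left inf_le_right⟩
  · rintro ⟨n, R⟩ ⟨-, hR⟩
    obtain ⟨d, hdR, hdT⟩ := hF.1.nonempty_of_mem (Filter.inter_mem hR (hT n))
    obtain ⟨w, hw, hwd⟩ := hSU n _ (hTS n (hx n)) _ (hTS n hdT)
    refine ⟨x n + w, ⟨w, hw, 0, mem_of_mem_nhds (hU n), by rw [add_zero]⟩, ?_⟩
    change p (x n + w) ∈ R
    rwa [map_add, hwd, add_sub_cancel]
  · intro W hW
    rw [uniformity_eq_comap_nhds_zero] at hW
    obtain ⟨W₀, hW₀, hWW₀⟩ := hW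
    obtain ⟨W₁, hW₁, hWW₁⟩ := exists_nhds_zero_half hW₀
    have hV : i ⁻¹' W₁ ∈ 𝓝 (0 : Y) :=
      hi.continuous.continuousAt.preimage_mem_nhds (by rwa [map_zero])
    obtain ⟨n, hn⟩ := hUY _ hV
    obtain ⟨R, hR, hRR⟩ := hsmall _ (Filter.inter_mem hW₁ (hU (n + 1)))
    -- The offset 3 pays for three operations: adding two elements of `U (n + 3)`, subtracting two
    -- such sums, and subtracting `w`, which lies in `U (n + 1)`. This puts `i y` in `U n`.
    refine ⟨_, hbasis.mem_of_mem (i := (n + 3, R)) ⟨_root_.trivial, hR⟩, ?_⟩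
    rintro ⟨a, b⟩ ⟨⟨ha, haR⟩, hb, hbR⟩
    obtain ⟨w, ⟨hw, hwU⟩, hwab⟩ := hRR _ haR _ hbR
    obtain ⟨y, hy⟩ := (he (b - a - w)).1 (by rw [map_sub, hwab, map_sub, sub_self])
    have hyU : i y ∈ U n := by
      obtain ⟨u, hu, v, hv, rfl⟩ := ha
      obtain ⟨u', hu', v', hv', rfl⟩ := hb
      rw [hy, show x (n + 3) + u' + v' - (x (n + 3) + u + v) - w = (u' + v') - (u + v) - w by abel]
      exact (hUU _ _ (hUU _ _ (hUU _ _ hu' _ hv').1 _ (hUU _ _ hu _ hv).1).2 _ hwU).2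
    refine hWW₀ ?_
    change b - a ∈ W₀
    rw [show b - a = i y + w by rw [hy]; abel]
    exact hWW₁ _ (hn y hyU) _ hw

/-! ### The closure of the graph of the projection. -/

/-- This supplies the corrections used below: an approximating point whose projection is near 0 can
be changed by a small element into one that projects to 0 exactly. -/
theorem exists_open_image_of_isOpenMap {Z X H : Type*} [AddCommGroup Z] [Module ℝ Z]
    [TopologicalSpace Z] [AddCommGroup X] [Module ℝ X] [TopologicalSpace X]
    [AddCommGroup H] [Module ℝ H] [TopologicalSpace H] {D : Submodule ℝ Z} (j : X →L[ℝ] H)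
    (p : X →L[ℝ] D) (hp : IsOpenMap p) {V : Set H} (hV : V ∈ 𝓝 0) :
    ∃ O : Set Z, IsOpen O ∧ 0 ∈ O ∧ ∀ d : D, (d : Z) ∈ O → ∃ v, j v ∈ V ∧ p v = d := by
  have h1 : j ⁻¹' V ∈ 𝓝 0 := j.continuous.continuousAt.preimage_mem_nhds (by rwa [map_zero])
  have h2 := hp.image_mem_nhds h1
  rw [map_zero, nhds_subtype_eq_comap] at h2
  obtain ⟨t, ht, h⟩ := h2
  obtain ⟨O, hOt, hO, h0⟩ := mem_nhds_iff.1 ht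
  exact ⟨O, hO, h0, fun d hd => h (hOt hd)⟩

section GraphClosure

variable {Z Y X H : Type*}
  [AddCommGroup Z] [Module ℝ Z] [TopologicalSpace Z] [IsTopologicalAddGroup Z]
  [ContinuousSMul ℝ Z]
  [AddCommGroup X] [Module ℝ X] [AddCommGroup H] [Module ℝ H]

/-- The closure, in `H × Z`, of the graph of a map `p : X → D ⊆ Z`, where `X` is sent to `H`
by `j`. -/
def graphClosure [TopologicalSpace X] [TopologicalSpace H] [IsTopologicalAddGroup H]
    [ContinuousSMul ℝ H] {D : Submodule ℝ Z} (j : X →L[ℝ] H) (p : X →L[ℝ] D) :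
    Submodule ℝ (H × Z) :=
  (LinearMap.range (j.prod (D.subtypeL.comp p)).toLinearMap).topologicalClosure

section Topological

variable [TopologicalSpace X] [TopologicalSpace H] [IsTopologicalAddGroup H]
  [ContinuousSMul ℝ H] {D : Submodule ℝ Z} (j : X →L[ℝ] H) (p : X →L[ℝ] D)

theorem mk_mem_graphClosure (x : X) : (j x, (p x : Z)) ∈ graphClosure j p :=
  Submodule.le_topologicalClosure _ ⟨x, rfl⟩

theorem exists_mem_of_mem_graphClosure {q : H × Z} (hq : q ∈ graphClosure j p) {s : Set H}
    (hs : s ∈ 𝓝 q.1) {t : Set Z} (ht : t ∈ 𝓝 q.2) : ∃ x, j x ∈ s ∧ (p x : Z) ∈ t := by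
  obtain ⟨_, h, ⟨x, rfl⟩⟩ := mem_closure_iff_nhds.1 hq _ (prod_mem_nhds hs ht)
  exact ⟨x, h.1, h.2⟩

variable [TopologicalSpace Y] [AddCommGroup Y] [Module ℝ Y] (i : Y →L[ℝ] X)

/-- Approximate (h, 0) by (j x, p x) and subtract from x a small v with the same projection: x - v
comes from `Y`, and j (x - v) is still near h. -/
theorem mem_closure_of_mem_graphClosure (hp : IsOpenMap p) (he : Function.Exact i p) {h : H}
    (hh : (h, 0) ∈ graphClosure j p) : h ∈ closure (Set.range fun y => j (i y)) := by
  rw [mem_closure_iff_nhds]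
  intro s hs
  have hsub : Filter.Tendsto (fun q : H × H => q.1 - q.2) (𝓝 h ×ˢ 𝓝 0) (𝓝 h) := by
    rw [← nhds_prod_eq]
    exact Continuous.tendsto' (by fun_prop) _ _ (by simp)
  obtain ⟨A, hA, V, hV, hAV⟩ := Filter.mem_prod_iff.1 (hsub hs)
  obtain ⟨O, hO, h0, hOV⟩ := exists_open_image_of_isOpenMap j p hp hV
  obtain ⟨x, hxA, hxO⟩ := exists_mem_of_mem_graphClosure j p hh hA (hO.mem_nhds h0)
  obtain ⟨v, hv, hpv⟩ := hOV _ hxO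
  obtain ⟨y, hy⟩ := (he (x - v)).1 (by rw [map_sub, hpv, sub_self])
  refine ⟨j (i y), ?_, y, rfl⟩
  rw [hy, map_sub]
  exact hAV (Set.mk_mem_prod hxA hv)

/-- For z near 0, an arbitrary h over z may be large. Subtracting a nearby j x and adding j v, with
v small and p v = p x, leaves z unchanged and makes the first coordinate small. -/
theorem isOpenMap_snd_graphClosure (hp : IsOpenMap p)
    (hsurj : ∀ z, ∃ h, (h, z) ∈ graphClosure j p) :
    IsOpenMap fun q : graphClosure j p => q.1.2 := by
  let f : graphClosure j p →+ Z :=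
    (AddMonoidHom.snd H Z).comp (graphClosure j p).subtype.toAddMonoidHom
  refine (IsTopologicalAddGroup.isOpenMap_iff_nhds_zero (f := f)).2 ?_
  intro N hN
  rw [Filter.mem_map, nhds_subtype_eq_comap] at hN
  obtain ⟨M, hM, hMN⟩ := hN
  obtain ⟨W, hW, W', hW', hWM⟩ := mem_nhds_prod_iff.1 hM
  obtain ⟨V, hV, hVW⟩ := exists_nhds_zero_half hW
  obtain ⟨O, hO, h0, hOV⟩ := exists_open_image_of_isOpenMap j p hp hV
  filter_upwards [hO.mem_nhds h0, hW'] with z hzO hzW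
  obtain ⟨h, hh⟩ := hsurj z
  have hs : {a | h - a ∈ V} ∈ 𝓝 h :=
    (Continuous.tendsto' (f := fun a => h - a) (by fun_prop) h 0 (sub_self h)) hV
  obtain ⟨x, hxV, hxO⟩ := exists_mem_of_mem_graphClosure j p hh hs (hO.mem_nhds hzO)
  obtain ⟨v, hv, hpv⟩ := hOV _ hxO
  have hmem : (h - j x + j v, z) ∈ graphClosure j p := by
    have := Submodule.sub_mem _ hh (mk_mem_graphClosure j p (x - v))
    convert this using 1
    refine Prod.ext ?_ ?_
    · simp only [Prod.fst_sub, map_sub]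
      abel
    · simp [hpv]
  exact hMN (a := ⟨_, hmem⟩) (hWM (Set.mk_mem_prod (hVW _ hxV _ hv) hzW))

end Topological

/-- Lift the trace on `D` of the neighbourhoods of z to a Cauchy filter on `X`; its image in `H`
converges, and its limit is the required h. -/
theorem exists_mem_graphClosure [UniformSpace X] [IsUniformAddGroup X] [UniformSpace H]
    [IsUniformAddGroup H] [ContinuousSMul ℝ H] [CompleteSpace H]
    [AddCommGroup Y] [Module ℝ Y] [TopologicalSpace Y] [FirstCountableTopology Y]
    {D : Submodule ℝ Z} (hD : Dense (D : Set Z))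
    (j : X →L[ℝ] H) (p : X →L[ℝ] D) (i : Y →L[ℝ] X) (hi : IsInducing i) (hp : IsOpenMap p)
    (hs : Function.Surjective p) (he : Function.Exact i p) (z : Z) :
    ∃ h, (h, z) ∈ graphClosure j p := by
  let _ : UniformSpace Z := IsTopologicalAddGroup.rightUniformSpace Z
  have : IsUniformAddGroup Z := isUniformAddGroup_of_addCommGroup
  have : IsUniformAddGroup D := D.toAddSubgroup.isUniformAddGroup
  have hF : Cauchy (Filter.comap ((↑) : D → Z) (𝓝 z)) :=
    cauchy_nhds.comap' le_rfl (mem_closure_iff_comap_neBot.1 (hD z))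
  obtain ⟨G, hG, hGF⟩ := hF.exists_lift_of_exact i.toLinearMap.toAddMonoidHom
    p.toLinearMap.toAddMonoidHom hi hp hs he
  obtain ⟨h, hh⟩ := CompleteSpace.complete (hG.map (uniformContinuous_addMonoidHom_of_continuous
    (f := j) j.continuous))
  have := hG.1
  refine ⟨h, mem_closure_of_tendsto (f := fun x => (j x, (p x : Z))) (b := G)
    (Filter.Tendsto.prodMk_nhds hh ?_) (Filter.Eventually.of_forall fun x => ⟨x, rfl⟩)⟩
  exact Filter.tendsto_comap.comp hGF

end GraphClosure

/-! ### Pull-backs and Baer sums. -/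

namespace TVSExtension

section Pullback

variable {Z Z₁ : Type u} {Y : Type v}
  [AddCommGroup Z] [Module ℝ Z] [TopologicalSpace Z]
  [AddCommGroup Z₁] [Module ℝ Z₁] [TopologicalSpace Z₁]
  [IsTopologicalAddGroup Z₁] [ContinuousSMul ℝ Z₁] [T2Space Z₁]
  [AddCommGroup Y] [Module ℝ Y] [TopologicalSpace Y]

/-- The canonical map from the middle space of the pull-back `E t` to that of `E`. -/
def fromPullback (E : TVSExtension Z Y) (t : Z₁ →L[ℝ] Z) : (E.pullback t).X →L[ℝ] E.X :=
  (ContinuousLinearMap.fst ℝ E.X Z₁).comp (Submodule.subtypeL _)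

theorem π_fromPullback (E : TVSExtension Z Y) (t : Z₁ →L[ℝ] Z) (x : (E.pullback t).X) :
    E.π (E.fromPullback t x) = t ((E.pullback t).π x) := x.2

/-- The universal property of the pull-back. -/
def pullbackLift (E : TVSExtension Z Y) (t : Z₁ →L[ℝ] Z) {W : Type*} [AddCommGroup W]
    [Module ℝ W] [TopologicalSpace W] (f : W →L[ℝ] E.X) (g : W →L[ℝ] Z₁)
    (h : ∀ w, E.π (f w) = t (g w)) : W →L[ℝ] (E.pullback t).X :=
  (f.prod g).codRestrict (E.pullbackSubmodule t) h

theorem pullbackLift_eq_ι (E : TVSExtension Z Y) (t : Z₁ →L[ℝ] Z) {W : Type*} [AddCommGroup W]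
    [Module ℝ W] [TopologicalSpace W] (f : W →L[ℝ] E.X) (g : W →L[ℝ] Z₁)
    (h : ∀ w, E.π (f w) = t (g w)) {w : W} {y : Y} (hf : f w = E.ι y) (hg : g w = 0) :
    E.pullbackLift t f g h w = (E.pullback t).ι y :=
  Subtype.ext (Prod.ext hf hg)

/-- An extension which completes the pull-back diagram is equivalent to the pull-back
extension. -/
theorem equivalent_pullback (E : TVSExtension Z Y) (t : Z₁ →L[ℝ] Z) (E' : TVSExtension Z₁ Y)
    (s : E'.X →L[ℝ] E.X) (h₁ : ∀ y, s (E'.ι y) = E.ι y) (h₂ : ∀ x, E.π (s x) = t (E'.π x)) :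
    E'.Equivalent (E.pullback t) :=
  ⟨E.pullbackLift t s E'.π h₂, fun y => E.pullbackLift_eq_ι t _ _ _ (h₁ y) (E'.π_ι y),
    fun _ => rfl⟩

theorem pullback_congr {E E' : TVSExtension Z Y} (t : Z₁ →L[ℝ] Z) (h : E.Equivalent E') :
    (E.pullback t).Equivalent (E'.pullback t) := by
  obtain ⟨T, h1, h2⟩ := h
  exact equivalent_pullback _ _ _ (T.comp (E.fromPullback t)) h1
    fun x => (h2 _).trans (E.π_fromPullback t x)

/-- The pull-back along a map is compatible with the Baer sum. -/
theorem baerSum_pullback [IsTopologicalAddGroup Z] [ContinuousSMul ℝ Z] [T2Space Z]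
    [IsTopologicalAddGroup Y] [ContinuousSMul ℝ Y] [T2Space Y] (E₁ E₂ : TVSExtension Z Y)
    (t : Z₁ →L[ℝ] Z) :
    ((E₁.pullback t).baerSum (E₂.pullback t)).Equivalent ((E₁.baerSum E₂).pullback t) := by
  let P := (E₁.pullback t).prodDiag (E₂.pullback t)
  let f₁ : P.X →L[ℝ] E₁.X := (E₁.fromPullback t).comp (fst _ _)
  let f₂ : P.X →L[ℝ] E₂.X := (E₂.fromPullback t).comp (snd _ _)
  have h₁ : ∀ x, E₁.π (f₁ x) = t (P.π x) := fun x =>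
    (E₁.π_fromPullback t _).trans (congrArg t (π_fst _ _ x))
  have h₂ : ∀ x, E₂.π (f₂ x) = t (P.π x) := fun x =>
    (E₂.π_fromPullback t _).trans (congrArg t (π_snd _ _ x))
  -- `g` covers `t` and is the identity on `Y × Y`. Composed with the map to the Baer sum, it
  -- becomes addition on `Y × Y`, as the universal property of the push-out requires.
  let g : P.X →L[ℝ] (E₁.prodDiag E₂).X := (E₁.prod E₂).pullbackLift _ (f₁.prod f₂) (t.comp P.π)
    fun x => Prod.ext (h₁ x) (h₂ x)
  refine baerSum_equivalent _ _ _ ((E₁.baerSum E₂).pullbackLift t ((toBaerSum E₁ E₂).comp g) P.π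
    fun _ => rfl) (fun y => ?_) (fun _ => rfl)
  refine pullbackLift_eq_ι _ _ _ _ _ ?_ (P.π_ι y)
  refine (congrArg (toBaerSum E₁ E₂) ?_).trans (toBaerSum_ι E₁ E₂ y)
  exact (E₁.prod E₂).pullbackLift_eq_ι _ _ _ _ rfl ((congrArg t (P.π_ι y)).trans (map_zero t))

end Pullback

/-! ### Restriction to a dense subspace. -/

section Dense

variable {Z : Type u} {Y : Type v}
  [AddCommGroup Z] [Module ℝ Z] [TopologicalSpace Z]
  [IsTopologicalAddGroup Z] [ContinuousSMul ℝ Z] [T2Space Z]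
  [AddCommGroup Y] [Module ℝ Y] [UniformSpace Y]
  [IsUniformAddGroup Y] [CompleteSpace Y]
  {D : Submodule ℝ Z}

/-- An extension by a complete space splits if its restriction to a dense subspace does. -/
theorem equivalent_trivial_of_pullback [ContinuousSMul ℝ Y] [T2Space Y]
    (hD : Dense (D : Set Z)) (E : TVSExtension Z Y)
    (h : (E.pullback D.subtypeL).Equivalent (trivial D Y)) : E.Equivalent (trivial Z Y) := by
  obtain ⟨T, h1, h2⟩ := h
  let r : (E.pullback D.subtypeL).X →L[ℝ] Y := (ContinuousLinearMap.fst ℝ Y D).comp T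
  have hr : ∀ y, r ((E.pullback D.subtypeL).ι y) = y := fun y => congrArg Prod.fst (h1 y)
  let e : (E.pullback D.subtypeL).X →L[ℝ] E.X := E.fromPullback D.subtypeL
  have hdense : DenseRange e := by
    refine (hD.preimage E.isOpenMap_π).mono fun x hx => ?_
    exact ⟨⟨(x, ⟨E.π x, hx⟩), rfl⟩, rfl⟩
  let _ : UniformSpace E.X := IsTopologicalAddGroup.rightUniformSpace E.X
  have : IsUniformAddGroup E.X := isUniformAddGroup_of_addCommGroup
  let _ : UniformSpace (E.pullback D.subtypeL).X := IsTopologicalAddGroup.rightUniformSpace _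
  have : IsUniformAddGroup (E.pullback D.subtypeL).X := isUniformAddGroup_of_addCommGroup
  -- The pull-back has the topology of a subspace of `E.X × D`, but its second coordinate is a
  -- continuous function of the first, so `E.X` alone induces this topology.
  have hind : IsInducing e := by
    have h3 : IsInducing fun x : E.X × D => (x.1, (x.2 : Z)) :=
      IsInducing.id.prodMap IsInducing.subtypeVal
    have h4 : IsInducing fun x : (E.pullback D.subtypeL).X => (e x, E.π (e x)) := by
      have h5 : (fun x => (e x, E.π (e x))) =
          (fun x : E.X × D => (x.1, (x.2 : Z))) ∘ (E.pullbackSubmodule D.subtypeL).subtype :=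
        funext fun x => Prod.ext rfl x.2
      rw [h5]
      exact h3.comp IsInducing.subtypeVal
    exact IsInducing.of_comp e.continuous (continuous_id.prodMk E.π.continuous) h4
  have hext := r.extend_eq hdense (AddMonoidHom.isUniformInducing_of_isInducing hind)
  refine ⟨(r.extend e).prod E.π, fun y => Prod.ext ?_ (E.π_ι y), fun _ => rfl⟩
  exact (hext _).trans (hr y)

/-- An extension by a complete metrizable space of a dense subspace of `Z` is the restriction of an
extension of `Z`. -/
theorem exists_pullback_equivalent [TopologicalSpace.MetrizableSpace Y]
    (hD : Dense (D : Set Z)) (E : TVSExtension D Y) :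
    ∃ E' : TVSExtension Z Y, (E'.pullback D.subtypeL).Equivalent E := by
  let _ : UniformSpace E.X := IsTopologicalAddGroup.rightUniformSpace E.X
  have : IsUniformAddGroup E.X := isUniformAddGroup_of_addCommGroup
  have : UniformContinuousConstSMul ℝ E.X := uniformContinuousConstSMul_of_continuousConstSMul _ _
  have : ContinuousSMul ℝ (UniformSpace.Completion E.X) :=
    UniformSpace.Completion.continuousSMul_real E.X
  let j : E.X →L[ℝ] UniformSpace.Completion E.X :=
    { toFun := (↑)
      map_add' := UniformSpace.Completion.coe_add
      map_smul' := UniformSpace.Completion.coe_smul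
      cont := UniformSpace.Completion.continuous_coe E.X }
  have : FirstCountableTopology Y := by
    let _ := TopologicalSpace.metrizableSpaceMetric Y
    infer_instance
  have hind : IsInducing fun y => j (E.ι y) :=
    UniformSpace.Completion.isDenseInducing_coe.isInducing.comp E.isEmbedding_ι.isInducing
  -- The image of `Y` is complete, hence closed in the Hausdorff completion; this makes the new
  -- sequence exact.
  have hclosed : IsClosed (Set.range fun y => j (E.ι y)) :=
    (AddMonoidHom.isUniformInducing_of_isInducing
      (f := (j.comp E.ι)) hind).isComplete_range.isClosed
  have hsurj := exists_mem_graphClosure hD j E.π E.ι E.isEmbedding_ι.isInducing E.isOpenMap_π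
    E.surjective_π E.exact
  let ι' : Y →L[ℝ] graphClosure j E.π :=
    ((ContinuousLinearMap.inl ℝ _ Z).comp (j.comp E.ι)).codRestrict _ fun y => by
      have := mk_mem_graphClosure j E.π (E.ι y)
      rwa [π_ι] at this
  let E' : TVSExtension Z Y :=
    { X := graphClosure j E.π
      ι := ι'
      π := (ContinuousLinearMap.snd ℝ _ Z).comp (Submodule.subtypeL _)
      isEmbedding_ι := by
        refine IsEmbedding.codRestrict (e := fun y => (j (E.ι y), (0 : Z))) ?_ _ _
        exact (isEmbedding_prodMkLeft (0 : Z)).comp hind.isEmbedding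
      isOpenMap_π := isOpenMap_snd_graphClosure j E.π E.isOpenMap_π hsurj
      surjective_π := fun z => (hsurj z).elim fun h hh => ⟨⟨(h, z), hh⟩, rfl⟩
      exact := by
        rintro ⟨⟨h, z⟩, hh⟩
        constructor
        · intro hz
          change z = 0 at hz
          subst hz
          have := mem_closure_of_mem_graphClosure j E.π E.ι E.isOpenMap_π E.exact hh
          rw [hclosed.closure_eq] at this
          obtain ⟨y, rfl⟩ := this
          exact ⟨y, rfl⟩
        · rintro ⟨y, hy⟩
          exact (congrArg (fun a : graphClosure j E.π => a.1.2) hy).symm }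
  -- The map x ↦ (j x, π x) completes the pull-back diagram. That no further points lie over `D`
  -- needs no check, because a morphism of extensions is automatically an isomorphism.
  refine ⟨E', (equivalent_pullback E' D.subtypeL E ((j.prod (D.subtypeL.comp E.π)).codRestrict
    (graphClosure j E.π) (mk_mem_graphClosure j E.π)) (fun y => Subtype.ext (Prod.ext rfl ?_))
    fun _ => rfl).symm⟩
  exact congrArg Subtype.val (E.π_ι y)

end Dense

end TVSExtension

/-! ### Restriction as a group isomorphism. -/

namespace ExtTVS

/-- The map `Ext_TVS(Z, Y) → Ext_TVS(Z₁, Y)` induced by the pull-back along `t : Z₁ → Z`. -/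
def pullback {Z Z₁ : Type u} {Y : Type v}
    [AddCommGroup Z] [Module ℝ Z] [TopologicalSpace Z]
    [IsTopologicalAddGroup Z] [ContinuousSMul ℝ Z] [T2Space Z]
    [AddCommGroup Z₁] [Module ℝ Z₁] [TopologicalSpace Z₁]
    [IsTopologicalAddGroup Z₁] [ContinuousSMul ℝ Z₁] [T2Space Z₁]
    [AddCommGroup Y] [Module ℝ Y] [TopologicalSpace Y]
    [IsTopologicalAddGroup Y] [ContinuousSMul ℝ Y] [T2Space Y] (t : Z₁ →L[ℝ] Z) :
    ExtTVS Z Y →+ ExtTVS Z₁ Y :=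
  AddMonoidHom.mk' (Quotient.map (fun E => E.pullback t)
    fun _ _ => TVSExtension.pullback_congr t) (by
      rintro ⟨E₁⟩ ⟨E₂⟩
      exact Quotient.sound (TVSExtension.baerSum_pullback E₁ E₂ t).symm)

end ExtTVS

theorem theorem3p8 {Z : Type u} {Y : Type v}
    [AddCommGroup Z] [Module ℝ Z] [TopologicalSpace Z]
    [IsTopologicalAddGroup Z] [ContinuousSMul ℝ Z] [T2Space Z]
    [AddCommGroup Y] [Module ℝ Y] [UniformSpace Y]
    [IsUniformAddGroup Y] [ContinuousSMul ℝ Y]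
    [CompleteSpace Y] [TopologicalSpace.MetrizableSpace Y]
    (D : Submodule ℝ Z) (hD : Dense (D : Set Z)) :
    Nonempty (ExtTVS Z Y ≃+ ExtTVS D Y) := by
  refine ⟨AddEquiv.ofBijective (ExtTVS.pullback D.subtypeL) ⟨?_, ?_⟩⟩
  · rw [injective_iff_map_eq_zero]
    rintro ⟨E⟩ h
    exact Quotient.sound (TVSExtension.equivalent_trivial_of_pullback hD E (Quotient.exact h))
  · rintro ⟨E⟩
    obtain ⟨E', h⟩ := TVSExtension.exists_pullback_equivalent hD E
    exact ⟨Quotient.mk _ E', Quotient.sound h⟩
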